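/- Let $[n,\overline n]=\{1,\dots,n,\overline 1,\dots,\overline n\}$ with the involution $i\leftrightarrow\overline i$, applied elementwise to subsets, and let $\mathrm{AdS}_n$ be the set of admissible subsets of $[n,\overline n]$, i.e. those containing at most one of $i$ and $\overline i$ for each $i\in[n]$. For $S\in\mathrm{AdS}_n$ put $e_S=\sum_{a\in S}e_a\in\mathbb R^n$, where $e_1,\dots,e_n$ is the standard basis and $e_{\overline i}=-e_i$. A delta-matroid $D$ on $[n,\overline n]$ is a non-empty collection $\mathcal F$ of admissible sets of size $n$ such that every edge of the polytope $P(D)=\mathrm{Conv}\{e_B : B\in\mathcal F\}$ is parallel to $e_i$ for some $i$ or to $e_i+e_j$ or $e_i-e_j$ for some $i\ne j$; $D$ is even if every edge of $P(D)$ is parallel to $e_i+e_j$ or $e_i-e_j$ for some $i\neq j$. The rank function of $D$ is $$g_D\colon\mathrm{AdS}_n\to\mathbb Z,\qquad g_D(S)=\max_{B\in\mathcal F}\bigl(|S\cap B|-|\overline S\cap B|\bigr).$$ For $S,T\in\mathrm{AdS}_n$ let $S\sqcup T=\{a\in S\cup T : \overline a\notin S\cup T\}$. **Theorem.** A function $g\colon\mathrm{AdS}_n\to\mathbb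 Z$ is the rank function of a delta-matroid on $[n,\overline n]$ if and only if 1. $g(\emptyset)=0$, 2. $|g(S)|\le 1$ whenever $|S|=1$, 3. $g(S)+g(T)\ge g(S\cap T)+g(S\sqcup T)$ for all $S,T\in\mathrm{AdS}_n$, and 4. $g(S)\equiv|S|\pmod 2$ for all $S\in\mathrm{AdS}_n$. Furthermore, a delta-matroid $D$ on $[n,\overline n]$ is even if and only if $$g_D(S)=\frac{g_D(S\cup\{i\})+g_D(S\cup\{\overline i\})}{2}$$ for all $S\in\mathrm{AdS}_n$ and $i\in[n]$ with $|S|=n-1$ and $S\cap\{i,\overline i\}=\emptyset$. -/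

import Mathlib

/-- The ground set `[n, n̄] = {1, …, n, 1̄, …, n̄}`: `Sum.inl i` is the element `i` and
`Sum.inr i` is the element `ī`. -/
abbrev SignedGround (n : ℕ) : Type := Fin n ⊕ Fin n

/-- A subset of `[n, n̄]` is admissible if it contains at most one of `i` and `ī` for each `i`. -/
def IsAdmissible {n : ℕ} (S : Finset (SignedGround n)) : Prop :=
  ∀ i : Fin n, ¬ (Sum.inl i ∈ S ∧ Sum.inr i ∈ S)

/-- The set `AdS_n` of admissible subsets of `[n, n̄]`. -/
abbrev AdS (n : ℕ) : Type := {S : Finset (SignedGround n) // IsAdmissible S}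

namespace AdS

variable {n : ℕ}

/-- The involution applied to a set: `S̄ = {ā : a ∈ S}`. -/
def bar (S : AdS n) : Finset (SignedGround n) := S.1.image Sum.swap

/-- The empty admissible set. -/
def empty (n : ℕ) : AdS n := ⟨∅, fun _ h => Finset.notMem_empty _ h.1⟩

/-- `S ∩ T` as an admissible set. -/
def inter (S T : AdS n) : AdS n :=
  ⟨S.1 ∩ T.1, fun i h =>
    S.2 i ⟨(Finset.mem_inter.1 h.1).1, (Finset.mem_inter.1 h.2).1⟩⟩

/-- `S ⊔ T = {a ∈ S ∪ T : ā ∉ S ∪ T}` as an admissible set. -/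
def sqUnion (S T : AdS n) : AdS n :=
  ⟨(S.1 ∪ T.1).filter (fun a => a.swap ∉ S.1 ∪ T.1), fun _ h =>
    (Finset.mem_filter.1 h.1).2 (Finset.mem_filter.1 h.2).1⟩

/-- `S ∪ {a}` as an admissible set, for `S` not containing `ā`. -/
def adjoin (S : AdS n) (a : SignedGround n) (ha : a.swap ∉ S.1) : AdS n :=
  ⟨insert a S.1, fun i h => by
    rcases Finset.mem_insert.1 h.1 with h1 | h1 <;> rcases Finset.mem_insert.1 h.2 with h2 | h2
    · exact absurd (h1.trans h2.symm) Sum.inl_ne_inr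
    · exact ha (h1 ▸ h2)
    · exact ha (h2 ▸ h1)
    · exact S.2 i ⟨h1, h2⟩⟩

/-- The vector `e_a ∈ ℝⁿ`, where `e_i` is a standard basis vector and `e_ī = -e_i`. -/
def elemVec : SignedGround n → (Fin n → ℝ)
  | Sum.inl i => Pi.single i 1
  | Sum.inr i => -Pi.single i 1

/-- The vector `e_S = ∑_{a ∈ S} e_a ∈ ℝⁿ`. -/
def vec (S : AdS n) : Fin n → ℝ := ∑ a ∈ S.1, elemVec a

end AdS

/-- `F` is an edge of the polytope `P`: a face (the set of maximizers on `P` of a linear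
functional) of dimension one. -/
def IsEdge {n : ℕ} (P F : Set (Fin n → ℝ)) : Prop :=
  IsExposed ℝ P F ∧ Module.finrank ℝ (vectorSpan ℝ F) = 1

/-- `F` is parallel to the line through the vector `v`. -/
def IsParallelTo {n : ℕ} (F : Set (Fin n → ℝ)) (v : Fin n → ℝ) : Prop :=
  vectorSpan ℝ F = Submodule.span ℝ {v}

/-- `F` is parallel to `e_i + e_j` or to `e_i - e_j` for some distinct `i` and `j`. -/
def IsParallelToPair {n : ℕ} (F : Set (Fin n → ℝ)) : Prop :=
  ∃ i j : Fin n, i ≠ j ∧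
    (IsParallelTo F (Pi.single i 1 + Pi.single j 1) ∨
      IsParallelTo F (Pi.single i 1 - Pi.single j 1))

/-- The polytope `Conv {e_B : B ∈ 𝓕}` of a collection `𝓕` of admissible sets. -/
def feasiblePolytope {n : ℕ} (𝓕 : Finset (AdS n)) : Set (Fin n → ℝ) :=
  convexHull ℝ (AdS.vec '' (𝓕 : Set (AdS n)))

/-- A delta-matroid on `[n, n̄]`: a non-empty collection of admissible sets of size `n`, the
feasible sets, such that every edge of `Conv {e_B : B feasible}` is parallel to some `e_i` or
some `e_i ± e_j`. -/
structure DeltaMatroid (n : ℕ) where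
  /-- The feasible sets. -/
  feasible : Finset (AdS n)
  nonempty : feasible.Nonempty
  card_eq : ∀ B ∈ feasible, B.1.card = n
  edges : ∀ F, IsEdge (feasiblePolytope feasible) F →
    (∃ i : Fin n, IsParallelTo F (Pi.single i 1)) ∨ IsParallelToPair F

namespace DeltaMatroid

variable {n : ℕ}

/-- The polytope `P(D)`. -/
def polytope (D : DeltaMatroid n) : Set (Fin n → ℝ) := feasiblePolytope D.feasible

/-- `D` is even if all edges of `P(D)` are parallel to some `e_i ± e_j`, `i ≠ j`. -/
def IsEven (D : DeltaMatroid n) : Prop := ∀ F, IsEdge D.polytope F → IsParallelToPair F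

/-- The rank function `g_D(S) = max_{B feasible} (|S ∩ B| - |S̄ ∩ B|)`. -/
def rank (D : DeltaMatroid n) (S : AdS n) : ℤ :=
  D.feasible.sup' D.nonempty
    (fun B => ((S.1 ∩ B.1).card : ℤ) - ((S.bar ∩ B.1).card : ℤ))

end DeltaMatroid

/-- `g` is bisubmodular: `g(S) + g(T) ≥ g(S ∩ T) + g(S ⊔ T)` for all admissible `S`, `T`. -/
def IsBisubmodular {n : ℕ} {R : Type*} [Add R] [LE R] (g : AdS n → R) : Prop :=
  ∀ S T : AdS n, g S + g T ≥ g (S.inter T) + g (S.sqUnion T)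

/-! An admissible set is a vector in {0, 1, -1}^n, feasible sets are vectors without zeros, and the
rank function is the support function `v ↦ max ⟨s, v⟩` of the feasible family. Both directions pass
through symmetric exchange, which is equivalent to every edge of the polytope changing at most two
coordinates (`exchange_of_card_diff_le`, `Exchange.card_diff_le`).

From a delta-matroid to the axioms, only bisubmodularity needs exchange. The pairing is modular
under `meet` and `join`, and `meet s t` lies below `join s t`, so it is enough that one feasible
vector maximises both pairings (`Exchange.exists_simultaneous_max`).

Conversely, take all full vectors obeying `pairing s v ≤ g s`. A greedy construction shows that
every inequality is attained, so `g` is recovered (`exists_feas_pairing_eq`). Uncrossing tight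
vectors, with all slacks even by parity, gives exchange (`exchange_feas`).

Evenness means that edges change exactly two coordinates, hence any two feasible vectors differ in
an even number of places (`even_card_diff`). A failure of the averaging identity would produce two
at odd distance, and an edge parallel to some `e_i` makes the identity fail. -/

namespace SignVec

/-! ### Sign vectors and their pairing -/

variable {ι : Type*}

/-- The sign vector of `S ∩ T`. -/
def meet (s t : ι → SignType) : ι → SignType := fun i => if s i = t i then s i else 0

/-- The sign vector of `S ⊔ T`. -/
def join (s t : ι → SignType) : ι → SignType := fun i =>
  if s i = 0 then t i else if t i = 0 ∨ s i = t i then s i else 0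

/-- All coordinates of `v` are non-zero. -/
def IsFull (v : ι → SignType) : Prop := ∀ i, v i ≠ 0

/-- `s` is obtained from `t` by setting some coordinates to zero. -/
def IsBelow (s t : ι → SignType) : Prop := ∀ i, s i = 0 ∨ s i = t i

/-- The symmetric exchange property of a family of sign vectors. -/
def Exchange [DecidableEq ι] (F : Set (ι → SignType)) : Prop :=
  ∀ v ∈ F, ∀ x ∈ F, ∀ i, v i ≠ x i →
    ∃ j, v j ≠ x j ∧ Function.update (Function.update v i (x i)) j (x j) ∈ F

theorem scalar_eq_neg {a b : SignType} (ha : a ≠ 0) (hb : b ≠ 0) (h : a ≠ b) :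
    (b : ℤ) = -(a : ℤ) := by
  revert ha hb h; revert a b; decide

theorem scalar_cases (a : SignType) : (a : ℤ) = 0 ∨ (a : ℤ) = 1 ∨ (a : ℤ) = -1 := by
  revert a; decide

theorem scalar_eq_one_or {a : SignType} (ha : a ≠ 0) : (a : ℤ) = 1 ∨ (a : ℤ) = -1 := by
  revert ha; revert a; decide

variable [Fintype ι]

/-- The standard pairing of sign vectors. -/
def pairing (s t : ι → SignType) : ℤ := ∑ i, (s i : ℤ) * (t i : ℤ)

theorem pairing_comm (s t : ι → SignType) : pairing s t = pairing t s := by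
  simp only [pairing, mul_comm]

/-- In each coordinate meet and join add up to `s i + t i`, conflicting signs included. So linear
functions turn bisubmodularity into an equality. -/
theorem pairing_meet_add_pairing_join (s t v : ι → SignType) :
    pairing (meet s t) v + pairing (join s t) v = pairing s v + pairing t v := by
  simp only [pairing, ← Finset.sum_add_distrib, ← add_mul]
  refine Finset.sum_congr rfl fun i _ => ?_
  congr 1
  simp only [meet, join]
  generalize s i = a
  generalize t i = b
  revert a b; decide

theorem two_dvd_pairing_sub {v : ι → SignType} (hv : IsFull v) (s : ι → SignType) :
    (2 : ℤ) ∣ pairing s v - ∑ i, (s i : ℤ) := by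
  rw [pairing, ← Finset.sum_sub_distrib]
  refine Finset.dvd_sum fun i _ => ?_
  have := hv i
  revert this
  generalize s i = a
  generalize v i = b
  revert a b; decide

variable [DecidableEq ι]

theorem pairing_update_left (s v : ι → SignType) (i : ι) (a : SignType) :
    pairing (Function.update s i a) v = pairing s v + ((a : ℤ) - s i) * v i := by
  have : ∀ k, ((Function.update s i a k : SignType) : ℤ) * (v k : ℤ) =
      (s k : ℤ) * v k + if k = i then ((a : ℤ) - s i) * v i else 0 := by
    intro k
    by_cases h : k = i
    · subst h; simp; ring
    · simp [h]
  simp only [pairing, this, Finset.sum_add_distrib]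
  simp

theorem pairing_update_right (s v : ι → SignType) (i : ι) (a : SignType) :
    pairing s (Function.update v i a) = pairing s v + s i * ((a : ℤ) - v i) := by
  rw [pairing_comm, pairing_update_left, pairing_comm, mul_comm]

/-- The conditions characterising rank functions, in terms of sign vectors. -/
structure IsRankFunction (g : (ι → SignType) → ℤ) : Prop where
  zero : g 0 = 0
  single : ∀ i a, a ≠ 0 → |g (Pi.single i a)| ≤ 1
  bisub : ∀ s t, g (meet s t) + g (join s t) ≤ g s + g t
  parity : ∀ s, (2 : ℤ) ∣ g s - ∑ i, (s i : ℤ)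

/-- The full sign vectors satisfying all inequalities prescribed by `g`. -/
def feas (g : (ι → SignType) → ℤ) : Set (ι → SignType) :=
  {v | IsFull v ∧ ∀ s, pairing s v ≤ g s}

end SignVec

/-! ### From a rank function to its feasible vectors -/

namespace SignVec

variable {ι : Type*} [Fintype ι] [DecidableEq ι]

theorem sum_update (s : ι → SignType) (i : ι) (a : SignType) :
    ∑ k, ((Function.update s i a k : SignType) : ℤ) = ∑ k, (s k : ℤ) + ((a : ℤ) - s i) := by
  simpa [pairing] using pairing_update_left s (fun _ => 1) i a

theorem neg_ne_zero_of_sign {a : SignType} (ha : a ≠ 0) : -a ≠ 0 := by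
  revert ha; revert a; decide

namespace IsRankFunction

variable {g : (ι → SignType) → ℤ}

/-- Joining with the singleton `a` adds coordinate `i` and joining with `-a` cancels it again;
bisubmodularity bounds both changes by 1, and parity excludes 0. -/
theorem update_sub (hg : IsRankFunction g) {c : ι → SignType} {i : ι} (hc : c i = 0)
    {a : SignType} (ha : a ≠ 0) :
    g (Function.update c i a) - g c = 1 ∨ g (Function.update c i a) - g c = -1 := by
  have h1 := hg.bisub c (Pi.single i a)
  have e1 : meet c (Pi.single i a) = 0 := by
    funext k
    by_cases h : k = i
    · subst h; simp [meet, hc]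
    · simp only [meet, Pi.single_apply, h, if_false, Pi.zero_apply]; split_ifs with h' <;> simp [h']
  have e2 : join c (Pi.single i a) = Function.update c i a := by
    funext k
    by_cases h : k = i
    · subst h; simp [join, hc]
    · simp +contextual [join, h]
  have h2 := hg.bisub (Function.update c i a) (Pi.single i (-a))
  have e3 : meet (Function.update c i a) (Pi.single i (-a)) = 0 := by
    funext k
    by_cases h : k = i
    · subst h
      simp [meet]
    · simp only [meet, Pi.single_apply, h, if_false, Pi.zero_apply]; split_ifs with h' <;> simp [h']
  have e4 : join (Function.update c i a) (Pi.single i (-a)) = c := by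
    funext k
    by_cases h : k = i
    · subst h
      have : ∀ a : SignType, (if a = 0 then -a else if -a = 0 ∨ a = -a then a else 0) = 0 := by
        decide
      simpa only [join, Function.update_self, Pi.single_eq_same, hc] using this a
    · simp +contextual [join, h]
  rw [e1, e2, hg.zero] at h1
  rw [e3, e4, hg.zero] at h2
  have h3 := abs_le.1 (hg.single i a ha)
  have h4 := abs_le.1 (hg.single i (-a) (neg_ne_zero_of_sign ha))
  have p1 := hg.parity c
  have p2 := hg.parity (Function.update c i a)
  rw [sum_update, hc] at p2
  have := scalar_eq_one_or ha
  simp only [SignType.coe_zero] at p2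
  omega

/-- The greedy algorithm: below `c` there is a full vector obeying all inequalities, and tight
at both `c` and a prescribed `s`. -/
theorem exists_greedy (hg : IsRankFunction g) (m : ℕ) : ∀ c : ι → SignType,
    (Finset.univ.filter (fun i => c i ≠ 0)).card = m → ∀ s, IsBelow s c →
    ∃ y : ι → SignType, IsFull y ∧ (∀ u, IsBelow u c → pairing u y ≤ g u) ∧
      pairing c y = g c ∧ pairing s y = g s := by
  induction m with
  | zero =>
    intro c hc s hs
    have hc0 : c = 0 := by
      funext i
      by_contra h
      rw [Finset.card_eq_zero] at hc
      have : i ∈ (∅ : Finset ι) := hc ▸ Finset.mem_filter.2 ⟨Finset.mem_univ i, h⟩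
      simp at this
    have h0 : ∀ u, IsBelow u c → u = 0 := fun u hu => by
      funext i
      rcases hu i with h | h <;> simp [h, hc0]
    subst hc0
    refine ⟨fun _ => 1, fun _ => by simp, fun u hu => ?_, ?_, ?_⟩
    · rw [h0 u hu, hg.zero]; simp [pairing]
    · rw [hg.zero]; simp [pairing]
    · rw [h0 s hs, hg.zero]; simp [pairing]
  | succ m ih =>
    intro c hc s hs
    have step : ∀ i, c i ≠ 0 → ∀ s', IsBelow s' (Function.update c i 0) →
        ∃ y : ι → SignType, IsFull y ∧ (∀ u, IsBelow u c → pairing u y ≤ g u) ∧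
          pairing c y = g c ∧ pairing s' y = g s' := by
      intro i hi s' hs'
      set c₀ := Function.update c i 0 with hc₀
      have hcard : (Finset.univ.filter (fun k => c₀ k ≠ 0)).card = m := by
        have : Finset.univ.filter (fun k => c₀ k ≠ 0) =
            (Finset.univ.filter (fun k => c k ≠ 0)).erase i := by
          ext k
          by_cases h : k = i
          · subst h; simp [hc₀]
          · simp [hc₀, h]
        rw [this, Finset.card_erase_of_mem (by simp [hi]), hc]; rfl
      obtain ⟨y, hy, hyu, hyc, hys⟩ := ih c₀ hcard s' hs'
      have hcc : Function.update c₀ i (c i) = c := by simp [hc₀]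
      have hd := hg.update_sub (c := c₀) (i := i) (by simp [hc₀]) hi
      rw [hcc] at hd
      -- Tightness at `c` forces the new coordinate; it is a sign because the increment of `g` is 1
      -- or -1.
      obtain ⟨τ, hτ, hτd⟩ : ∃ τ : SignType, τ ≠ 0 ∧ (c i : ℤ) * τ = g c - g c₀ := by
        have := scalar_eq_one_or hi
        rcases hd with hd | hd <;> rcases this with h | h <;> rw [hd, h]
        · exact ⟨1, by decide, by simp⟩
        · exact ⟨-1, by decide, by simp⟩
        · exact ⟨-1, by decide, by simp⟩
        · exact ⟨1, by decide, by simp⟩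
      have hup : ∀ u : ι → SignType, u i = 0 →
          pairing u (Function.update y i τ) = pairing u y := fun u hu => by
        rw [pairing_update_right, hu]; simp
      have hup' : ∀ u : ι → SignType, u i = c i → pairing u (Function.update y i τ) =
          pairing (Function.update u i 0) y + (g c - g c₀) := fun u hu => by
        rw [pairing_update_right, pairing_update_left, hu, ← hτd]; simp; ring
      refine ⟨Function.update y i τ, fun k => ?_, fun u hu => ?_, ?_, ?_⟩
      · by_cases h : k = i
        · subst h; simpa
        · simpa [h] using hy k
      · by_cases hui : u i = 0
        · rw [hup u hui]
          refine hyu u fun k => ?_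
          by_cases h : k = i
          · subst h; exact Or.inl hui
          · simpa [hc₀, h] using hu k
        · have hui' : u i = c i := (hu i).resolve_left hui
          -- Uncrossing `u` with the tight `c₀` bounds the increment at `c` by the increment at `u`
          -- without `i`.
          have hb := hg.bisub u c₀
          have e1 : meet u c₀ = Function.update u i 0 := by
            funext k
            by_cases h : k = i
            · subst h; simp [meet, hc₀, hui]
            · rcases hu k with h' | h' <;> simp +contextual [meet, hc₀, h, h']
          have e2 : join u c₀ = c := by
            funext k
            by_cases h : k = i
            · subst h; simp [join, hc₀, hui', hi]
            · rcases hu k with h' | h' <;> simp +contextual [join, hc₀, h, h']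
          have := hyu (Function.update u i 0) fun k => by
            by_cases h : k = i
            · subst h; simp
            · simpa [hc₀, h] using hu k
          rw [e1, e2] at hb
          rw [hup' u hui']
          linarith
      · rw [hup' c rfl, ← hc₀, hyc]; ring
      · rw [hup s' (by simpa [hc₀] using hs' i), hys]
    -- The last coordinate to be filled in should lie outside `s`, so that tightness at `s` is
    -- inherited; if `s = c`, any coordinate of the support will do.
    by_cases hsc : s = c
    · subst hsc
      obtain ⟨i, hi⟩ : (Finset.univ.filter (fun i => s i ≠ 0)).Nonempty :=
        Finset.card_pos.1 (by omega)
      obtain ⟨y, h1, h2, h3, -⟩ := step i (by simpa using hi) (Function.update s i 0)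
        (fun _ => Or.inr rfl)
      exact ⟨y, h1, h2, h3, h3⟩
    · obtain ⟨i, hi⟩ := Function.ne_iff.1 hsc
      have hsi : s i = 0 := (hs i).resolve_right hi
      refine step i (by rwa [hsi, ne_comm] at hi) s fun k => ?_
      by_cases h : k = i
      · subst h; exact Or.inl hsi
      · simpa [h] using hs k

/-- Run the greedy algorithm below a full `c` extending `s`. For arbitrary `t`, both `meet t c` and
`join t c` lie below `c`, so uncrossing `t` with the tight `c` yields the inequality at `t`. -/
theorem exists_feas_pairing_eq (hg : IsRankFunction g) (s : ι → SignType) :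
    ∃ y ∈ feas g, pairing s y = g s := by
  set c : ι → SignType := fun i => if s i = 0 then 1 else s i with hc
  have hcf : IsFull c := fun i => by
    simp only [hc]; split_ifs with h
    · decide
    · exact h
  obtain ⟨y, hy, hyu, hyc, hys⟩ := hg.exists_greedy _ c rfl s fun i => by
    by_cases h : s i = 0
    · exact Or.inl h
    · right; simp [hc, h]
  refine ⟨y, ⟨hy, fun t => ?_⟩, hys⟩
  have h1 := pairing_meet_add_pairing_join t c y
  have h2 := hg.bisub t c
  have h3 := hyu (meet t c) fun i => by
    simp only [meet]; split_ifs with h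
    · exact Or.inr h
    · exact Or.inl rfl
  have h4 := hyu (join t c) fun i => by
    have := hcf i
    revert this
    simp only [join]
    generalize t i = a
    generalize c i = b
    revert a b; decide
  linarith

/-- If flipping `i` alone is infeasible, the obstructions are the tight vectors agreeing with `x` at
`i`. They have a least member `s₀`, and feasibility of `x` supplies a `j` at which `s₀` opposes `x`.
Flipping `j` as well relaxes every obstruction, and uncrossing with `s₀` shows that no new one
appears. -/
theorem exchange_feas (hg : IsRankFunction g) : Exchange (feas g) := by
  intro v hv x hx i hi
  by_cases hvi : Function.update v i (x i) ∈ feas g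
  · exact ⟨i, hi, by simpa using hvi⟩
  have full : ∀ j, IsFull (Function.update (Function.update v i (x i)) j (x j)) := fun j k => by
    by_cases h : k = j
    · subst h; simpa using hx.1 k
    · by_cases h' : k = i
      · subst h'; simpa [h] using hx.1 k
      · simpa [h, h'] using hv.1 k
  have slack : ∀ s, (2 : ℤ) ∣ g s - pairing s v := fun s => by
    have h1 := hg.parity s
    have h2 := two_dvd_pairing_sub hv.1 s
    omega
  have shift : ∀ (s : ι → SignType) j, v j ≠ x j → (s j : ℤ) * ((x j : ℤ) - v j) = 2 * ((s j : ℤ) * x j) := by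
    intro s j hj
    rw [scalar_eq_neg (hx.1 j) (hv.1 j) hj.symm]; ring
  have cases : ∀ (s : ι → SignType) j, (s j : ℤ) * x j = 0 ∨ (s j : ℤ) * x j = 1 ∨
      (s j : ℤ) * x j = -1 := fun s j => by
    generalize s j = a; generalize x j = b; revert a b; decide
  have tight : ∀ s t, pairing s v = g s → pairing t v = g t →
      pairing (meet s t) v = g (meet s t) ∧ pairing (join s t) v = g (join s t) := by
    intro s t hs ht
    have h1 := pairing_meet_add_pairing_join s t v
    have h2 := hg.bisub s t
    have h3 := hv.2 (meet s t)
    have h4 := hv.2 (join s t)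
    constructor <;> linarith
  have meet_one : ∀ (s t : ι → SignType) k, (s k : ℤ) * x k = 1 → (t k : ℤ) * x k = 1 →
      (meet s t k : ℤ) * x k = 1 := fun s t k => by
    simp only [meet]
    generalize s k = a; generalize t k = b; generalize x k = c; revert a b c; decide
  have join_one : ∀ (s t : ι → SignType) k, (s k : ℤ) * x k ≠ -1 → (t k : ℤ) * x k = 1 →
      (join s t k : ℤ) * x k = 1 := fun s t k => by
    simp only [join]
    generalize s k = a; generalize t k = b; generalize x k = c; revert a b c; decide
  have meet_ne : ∀ (s t : ι → SignType) k, (s k : ℤ) * x k ≠ -1 → (t k : ℤ) * x k = -1 →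
      (meet s t k : ℤ) * x k ≠ -1 := fun s t k => by
    simp only [meet]
    generalize s k = a; generalize t k = b; generalize x k = c; revert a b c; decide
  have join_ne : ∀ (s t : ι → SignType) k, (s k : ℤ) * x k = 1 → (t k : ℤ) * x k = -1 →
      (join s t k : ℤ) * x k ≠ -1 := fun s t k => by
    simp only [join]
    generalize s k = a; generalize t k = b; generalize x k = c; revert a b c; decide
  -- Slacks are even and one flip raises a pairing by at most 2, so any inequality violated by the
  -- flip was tight.
  let T : Set (ι → SignType) := {s | pairing s v = g s ∧ (s i : ℤ) * x i = 1}
  have hT : T.Nonempty := by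
    have : ∃ s, g s < pairing s (Function.update v i (x i)) := by
      by_contra! h
      exact hvi ⟨by simpa using full i, h⟩
    obtain ⟨s, hs⟩ := this
    rw [pairing_update_right, shift s i hi] at hs
    have h1 := hv.2 s
    have h2 := slack s
    have h3 := cases s i
    exact ⟨s, by omega, by omega⟩
  obtain ⟨s₀, hs₀, hmin⟩ := (Set.toFinite T).exists_minimalFor
    (fun s : ι → SignType => (Finset.univ.filter (fun k => s k ≠ 0)).card) T hT
  have agree : ∀ s ∈ T, ∀ k, s₀ k ≠ 0 → s k = s₀ k := by
    intro s hs k hk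
    have hm : meet s s₀ ∈ T := ⟨(tight s s₀ hs.1 hs₀.1).1, meet_one s s₀ i hs.2 hs₀.2⟩
    have hsub : Finset.univ.filter (fun k => meet s s₀ k ≠ 0) ⊆
        Finset.univ.filter (fun k => s₀ k ≠ 0) := fun l hl => by
      have hl := (Finset.mem_filter.1 hl).2
      refine Finset.mem_filter.2 ⟨Finset.mem_univ l, ?_⟩
      simp only [meet] at hl
      split_ifs at hl with h
      · rwa [← h]
      · exact absurd rfl hl
    have heq := Finset.eq_of_subset_of_card_le hsub (hmin hm (Finset.card_le_card hsub))
    have : k ∈ Finset.univ.filter (fun k => meet s s₀ k ≠ 0) := heq ▸ by simp [hk]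
    have := (Finset.mem_filter.1 this).2
    by_contra h
    simp [meet, h] at this
  -- Otherwise `x` would pair with `s₀` at least as well as `v` everywhere and strictly better at
  -- `i`, exceeding `g s₀`.
  obtain ⟨j, hj, hsj⟩ : ∃ j, v j ≠ x j ∧ (s₀ j : ℤ) * x j = -1 := by
    by_contra! h
    have h1 : pairing s₀ x ≤ pairing s₀ v := hs₀.1 ▸ hx.2 s₀
    have h2 : pairing s₀ v < pairing s₀ x := by
      refine Finset.sum_lt_sum (fun k _ => ?_) ⟨i, Finset.mem_univ i, ?_⟩
      · by_cases hk : v k = x k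
        · rw [hk]
        · have := cases s₀ k
          have := h k hk
          have := shift s₀ k hk
          rw [mul_sub] at this
          omega
      · have := hs₀.2
        have := shift s₀ i hi
        rw [mul_sub] at this
        omega
    omega
  have hij : j ≠ i := fun h => by
    have := hs₀.2
    rw [h] at hsj; omega
  have hs₀j : s₀ j ≠ 0 := fun h => by simp [h] at hsj
  have agree' : ∀ s ∈ T, (s j : ℤ) * x j = -1 := fun s hs => by rw [agree s hs j hs₀j, hsj]
  refine ⟨j, hj, full j, fun s => ?_⟩
  by_contra! hs
  rw [pairing_update_right, pairing_update_right, Function.update_of_ne hij, shift s i hi,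
    shift s j hj] at hs
  have h1 := hv.2 s
  have h2 := slack s
  have h3 := cases s i
  have h4 := cases s j
  by_cases hst : pairing s v = g s
  · rcases h3 with h3 | h3 | h3
    · refine join_ne s s₀ j (by omega) hsj (agree' _ ⟨(tight s s₀ hst hs₀.1).2, ?_⟩)
      exact join_one s s₀ i (by omega) hs₀.2
    · have := agree' s ⟨hst, h3⟩
      omega
    · omega
  -- Here the slack at `s` is exactly 2 and `s` agrees with `x` at `i` and `j`. The slacks of meet
  -- and join are even with sum at most 2, so one of the two is tight and lies in `T` without
  -- opposing `x` at `j`.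
  · have hm := meet_one s s₀ i (by omega) hs₀.2
    have hk := join_one s s₀ i (by omega) hs₀.2
    have hm' := meet_ne s s₀ j (by omega) hsj
    have hk' := join_ne s s₀ j (by omega) hsj
    have e1 := pairing_meet_add_pairing_join s s₀ v
    have e2 := hg.bisub s s₀
    have e3 := hv.2 (meet s s₀)
    have e4 := hv.2 (join s s₀)
    have e5 := slack (meet s s₀)
    have e6 := slack (join s s₀)
    have e7 := hs₀.1
    by_cases hmt : pairing (meet s s₀) v = g (meet s s₀)
    · exact hm' (agree' _ ⟨hmt, hm⟩)
    · exact hk' (agree' _ ⟨by omega, hk⟩)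

end IsRankFunction
end SignVec

/-! ### Exchange, edges and simultaneous maximisers -/

namespace SignVec

variable {ι : Type*} [Fintype ι]

/-- The coordinates in which two sign vectors differ. -/
def diff (v x : ι → SignType) : Finset ι := Finset.univ.filter fun k => v k ≠ x k

@[simp] theorem mem_diff {v x : ι → SignType} {k : ι} : k ∈ diff v x ↔ v k ≠ x k := by
  simp [diff]

theorem diff_comm (v x : ι → SignType) : diff v x = diff x v := by
  ext; simp [ne_comm]

variable [DecidableEq ι]

/-- `w` is maximised over `F` exactly at the two distinct vectors `v` and `x`. -/
structure IsEdgePair (F : Set (ι → SignType)) (v x : ι → SignType) (w : ι → ℝ) : Prop where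
  left_mem : v ∈ F
  right_mem : x ∈ F
  ne : v ≠ x
  eq : ∑ k, w k * (v k : ℝ) = ∑ k, w k * (x k : ℝ)
  lt : ∀ z ∈ F, z ≠ v → z ≠ x → ∑ k, w k * (z k : ℝ) < ∑ k, w k * (v k : ℝ)

theorem sum_mul_update (w : ι → ℝ) (v : ι → SignType) (i : ι) (a : SignType) :
    ∑ k, w k * ((Function.update v i a k : SignType) : ℝ) =
      ∑ k, w k * (v k : ℝ) + w i * ((a : ℝ) - v i) := by
  have : ∀ k, w k * ((Function.update v i a k : SignType) : ℝ) =
      w k * (v k : ℝ) + if k = i then w i * ((a : ℝ) - v i) else 0 := by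
    intro k
    by_cases h : k = i
    · subst h; simp; ring
    · simp [h]
  simp only [this, Finset.sum_add_distrib]
  simp

theorem diff_update_update (v x : ι → SignType) {i j : ι} (hi : v i ≠ x i) (hj : v j ≠ x j) :
    diff v (Function.update (Function.update v i (x i)) j (x j)) = {i, j} := by
  ext k
  by_cases h : k = j
  · subst h; simpa
  · by_cases h' : k = i
    · subst h'; simpa [h]
    · simp [h, h']

/-- Exchange at the coordinate where `w` reacts most strongly, in the direction of increase. The
companion flip cannot undo the gain, so the result is again a maximiser; it is not `v`, hence it is
`x`. -/
theorem Exchange.card_diff_le {F : Set (ι → SignType)} (hF : Exchange F)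
    {v x : ι → SignType} {w : ι → ℝ} (h : IsEdgePair F v x w) : (diff v x).card ≤ 2 := by
  have main : ∀ v x, IsEdgePair F v x w → ∀ i ∈ diff v x,
      (∀ k ∈ diff v x, |w k * ((x k : ℝ) - v k)| ≤ w i * ((x i : ℝ) - v i)) →
      (diff v x).card ≤ 2 := by
    intro v x h i hi hmax
    rw [mem_diff] at hi
    obtain ⟨j, hj, hF'⟩ := hF v h.left_mem x h.right_mem i hi
    have hd := diff_update_update v x hi hj
    have hval : ∑ k, w k * (v k : ℝ) ≤ ∑ k, w k *
        ((Function.update (Function.update v i (x i)) j (x j) k : SignType) : ℝ) := by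
      rw [sum_mul_update, sum_mul_update]
      have hi0 := hmax i (by simpa using hi)
      have hj0 := hmax j (by simpa using hj)
      by_cases hij : j = i
      · subst hij
        have := abs_nonneg (w j * ((x j : ℝ) - v j))
        simp; linarith
      · rw [Function.update_of_ne hij]
        have := neg_abs_le (w j * ((x j : ℝ) - v j))
        linarith
    by_cases h1 : Function.update (Function.update v i (x i)) j (x j) = v
    · have : i ∈ diff v v := by rw [h1] at hd; simp [hd]
      simp at this
    by_cases h2 : Function.update (Function.update v i (x i)) j (x j) = x
    · rw [h2] at hd
      rw [hd]; exact Finset.card_le_two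
    · exact absurd (h.lt _ hF' h1 h2) (not_lt.2 hval)
  have hne : (diff v x).Nonempty := by
    obtain ⟨i, hi⟩ := Function.ne_iff.1 h.ne
    exact ⟨i, by simpa using hi⟩
  obtain ⟨i, hi, hmax⟩ := Finset.exists_max_image _ (fun k => |w k * ((x k : ℝ) - v k)|) hne
  rcases abs_cases (w i * ((x i : ℝ) - v i)) with ⟨h1, -⟩ | ⟨h1, -⟩
  · exact main v x h i hi fun k hk => h1 ▸ hmax k hk
  · rw [diff_comm]
    refine main x v ⟨h.right_mem, h.left_mem, h.ne.symm, h.eq.symm, fun z hz h1 h2 =>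
      h.eq ▸ h.lt z hz h2 h1⟩ i (by rwa [diff_comm]) fun k hk => ?_
    rw [diff_comm] at hk
    have := hmax k hk
    rw [h1] at this
    rw [← abs_neg, ← mul_neg, neg_sub]
    linarith

/-- Maximise `a` first and then `c`. If some `x` beats `v` on `c`, one closest to `v` is never worse
for `c` on a differing coordinate, nor for `a`, which lies below `c`. Exchanging `v` towards `x`
then improves `c` at no cost to `a`. -/
theorem Exchange.exists_simultaneous_max {F : Set (ι → SignType)} (hF : Exchange F)
    (hne : F.Nonempty) (hfull : ∀ v ∈ F, IsFull v) {a c : ι → SignType} (hac : IsBelow a c) :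
    ∃ v ∈ F, (∀ x ∈ F, pairing a x ≤ pairing a v) ∧ ∀ x ∈ F, pairing c x ≤ pairing c v := by
  obtain ⟨v₀, hv₀, hmax₀⟩ := (Set.toFinite F).exists_maximalFor (pairing a) F hne
  obtain ⟨v, ⟨hv, hva⟩, hmax⟩ := (Set.toFinite _).exists_maximalFor (pairing c)
    {v ∈ F | pairing a v = pairing a v₀} ⟨v₀, hv₀, rfl⟩
  have hamax : ∀ x ∈ F, pairing a x ≤ pairing a v := fun x hx => by
    rw [hva]; by_contra! h; exact absurd (hmax₀ hx h.le) (not_le.2 h)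
  have hcmax : ∀ x ∈ F, pairing a x = pairing a v → pairing c x ≤ pairing c v := by
    intro x hx hxa
    by_contra! h
    exact absurd (hmax ⟨hx, hxa.trans hva⟩ h.le) (not_le.2 h)
  refine ⟨v, hv, hamax, ?_⟩
  by_contra! hx
  obtain ⟨x, ⟨hxF, hx⟩, hmin⟩ := (Set.toFinite _).exists_minimalFor
    (fun x => (diff x v).card) {x ∈ F | pairing c v < pairing c x} hx
  have key : ∀ y z : ι → SignType, IsFull y → IsFull z → ∀ (s : ι → SignType) k, y k ≠ z k →
      (s k : ℤ) * ((z k : ℤ) - y k) = 2 * ((s k : ℤ) * z k) := by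
    intro y z hy hz s k hk
    rw [scalar_eq_neg (hz k) (hy k) hk.symm]; ring
  have cases : ∀ s y : ι → SignType, ∀ k, (s k : ℤ) * y k = 0 ∨ (s k : ℤ) * y k = 1 ∨
      (s k : ℤ) * y k = -1 := fun s y k => by
    generalize s k = a; generalize y k = b; revert a b; decide
  -- no coordinate of `c` prefers `v` over `x`
  have hno : ∀ k, x k ≠ v k → (c k : ℤ) * v k ≠ 1 := by
    intro i hi h1
    obtain ⟨j, hj, hF'⟩ := hF x hxF v hv i hi
    have hval : pairing c v <
        pairing c (Function.update (Function.update x i (v i)) j (v j)) := by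
      refine hx.trans_le ?_
      rw [pairing_update_right, pairing_update_right]
      have k1 := key x v (hfull x hxF) (hfull v hv) c i hi
      have k2 := key x v (hfull x hxF) (hfull v hv) c j hj
      by_cases hij : j = i
      · subst hij; simp; omega
      · rw [Function.update_of_ne hij]
        have := cases c v j
        omega
    have hlt : (diff (Function.update (Function.update x i (v i)) j (v j)) v).card <
        (diff x v).card := by
      refine Finset.card_lt_card ⟨fun k hk => ?_, fun h => ?_⟩
      · rw [mem_diff] at hk ⊢
        by_cases h : k = j
        · subst h; simp at hk
        · by_cases h' : k = i
          · subst h'; exact hi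
          · simpa [h, h'] using hk
      · have := h (mem_diff.2 hj)
        simp at this
    exact absurd (hmin ⟨hF', hval⟩ hlt.le) (not_le.2 hlt)
  obtain ⟨i, hi, hci⟩ : ∃ i, v i ≠ x i ∧ (c i : ℤ) * x i = 1 := by
    by_contra! h
    refine absurd hx (not_lt.2 (Finset.sum_le_sum fun k _ => ?_))
    by_cases hk : v k = x k
    · rw [hk]
    · have k1 := key v x (hfull v hv) (hfull x hxF) c k hk
      rw [mul_sub] at k1
      have := h k hk
      have := cases c x k
      omega
  obtain ⟨j, hj, hF'⟩ := hF v hv x hxF i hi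
  have hnn : ∀ k, v k ≠ x k → 0 ≤ (c k : ℤ) * x k := by
    intro k hk
    have := hno k hk.symm
    rw [scalar_eq_neg (hfull x hxF k) (hfull v hv k) hk.symm] at this
    have := cases c x k
    simp only [mul_neg] at *
    omega
  have hann : ∀ k, v k ≠ x k → 0 ≤ (a k : ℤ) * x k := by
    intro k hk
    rcases hac k with h | h
    · simp [h]
    · rw [h]; exact hnn k hk
  have change : ∀ s : ι → SignType, (∀ k, v k ≠ x k → 0 ≤ (s k : ℤ) * x k) →
      pairing s v + 2 * ((s i : ℤ) * x i) ≤
        pairing s (Function.update (Function.update v i (x i)) j (x j)) := by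
    intro s hs
    rw [pairing_update_right, pairing_update_right, key v x (hfull v hv) (hfull x hxF) s i hi]
    by_cases hij : j = i
    · subst hij; simp
    · rw [Function.update_of_ne hij, key v x (hfull v hv) (hfull x hxF) s j hj]
      have := hs j hj
      omega
  have e1 := change a hann
  have e2 := hann i hi
  have e3 := hamax _ hF'
  have e4 := change c hnn
  have e5 := hcmax _ hF' (by omega)
  omega

/-- From every `v ∈ F` there is an edge towards any other `x ∈ F` moving a prescribed
coordinate. -/
theorem exists_isEdgePair {n : ℕ} {F : Set (Fin n → SignType)} (hfull : ∀ v ∈ F, IsFull v)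
    {v x : Fin n → SignType} (hv : v ∈ F) (hx : x ∈ F) {i : Fin n} (hi : v i ≠ x i) :
    ∃ y w, IsEdgePair F v y w ∧ i ∈ diff v y ∧ diff v y ⊆ diff v x := by
  -- Distinct powers of two make the cost determine the set of flips, and one flip outside `diff v
  -- x` costs at least `2 ^ n`, more than all flips inside together.
  let e : Fin n → ℕ := fun k => if v k = x k then n + k else k
  have he : Function.Injective e := by
    intro k l h
    simp only [e] at h
    split_ifs at h <;> exact Fin.ext (by omega)
  let cost : (Fin n → SignType) → ℕ := fun z => ∑ k ∈ (diff v z).erase i, 2 ^ e k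
  have hcost : ∀ z ∈ F, ∀ y ∈ F, i ∈ diff v z → i ∈ diff v y → cost z = cost y → z = y := by
    intro z hz y hy hiz hiy h
    have h1 : ((diff v z).erase i).image e = ((diff v y).erase i).image e := by
      apply Finset.geomSum_injective (n := 2) le_rfl
      simp only [Finset.sum_image he.injOn]
      exact h
    have h2 := Finset.image_injective he h1
    have h3 : diff v z = diff v y := by
      rw [← Finset.insert_erase hiz, ← Finset.insert_erase hiy, h2]
    funext k
    have h4 : v k ≠ z k ↔ v k ≠ y k := by rw [← mem_diff, ← mem_diff, h3]
    have := hfull v hv k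
    have := hfull z hz k
    have := hfull y hy k
    revert h4 this
    revert this
    revert this
    generalize v k = a; generalize z k = b; generalize y k = c
    revert a b c; decide
  obtain ⟨y, ⟨hy, hiy⟩, hmin⟩ := (Set.toFinite _).exists_minimalFor cost
    {z ∈ F | i ∈ diff v z} ⟨x, hx, mem_diff.2 hi⟩
  have hle : ∀ z ∈ F, i ∈ diff v z → cost y ≤ cost z := fun z hz hiz => by
    by_contra! h
    exact absurd (hmin ⟨hz, hiz⟩ h.le) (not_le.2 h)
  have hxn : cost x < 2 ^ n := by
    have h1 : cost x ≤ ∑ k ∈ Finset.range n, 2 ^ k := by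
      simp only [cost]
      rw [← Finset.sum_image (f := fun k => 2 ^ k) he.injOn]
      refine Finset.sum_le_sum_of_subset fun k hk => ?_
      obtain ⟨l, hl, rfl⟩ := Finset.mem_image.1 hk
      have := mem_diff.1 (Finset.mem_of_mem_erase hl)
      simp [e, this]
    have h2 := Nat.geomSum_eq (le_refl 2) n
    have : 0 < 2 ^ n := by positivity
    simp at h2
    omega
  -- Each flip away from `v` loses twice its cost, while flipping `i` gains `2 * cost y`: exactly
  -- enough for the cheapest `y` to tie with `v`.
  let w : Fin n → ℝ := fun k => if k = i then -(cost y : ℝ) * v i else 2 ^ e k * v k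
  have hval : ∀ z ∈ F, ∑ k, w k * (z k : ℝ) = ∑ k, w k * (v k : ℝ) -
      2 * cost z + if i ∈ diff v z then 2 * (cost y : ℝ) else 0 := by
    intro z hz
    have hs : ∀ k, w k * (z k : ℝ) = w k * (v k : ℝ) -
        2 * (if k ∈ (diff v z).erase i then (2 : ℝ) ^ e k else 0) +
        if k = i then (if i ∈ diff v z then 2 * (cost y : ℝ) else 0) else 0 := by
      intro k
      have hsq : (v k : ℝ) * v k = 1 ∧ (v k ≠ z k → (z k : ℝ) = - v k) := by
        have := hfull v hv k
        have := hfull z hz k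
        rcases SignType.trichotomy (v k) with h | h | h <;>
          rcases SignType.trichotomy (z k) with h' | h' | h' <;> simp_all
      by_cases hk : k = i
      · subst hk
        by_cases hd : v k = z k
        · simp [hd]
        · simp only [w, mem_diff, hsq.2 hd]
          simp [hd]
          linear_combination 2 * (cost y : ℝ) * hsq.1
      · by_cases hd : v k = z k
        · simp [hd, hk]
        · simp only [w, hsq.2 hd, hk, if_false]
          simp [hd, hk]
          linear_combination (-2) * (2 : ℝ) ^ e k * hsq.1
    rw [Finset.sum_congr rfl fun k _ => hs k, Finset.sum_add_distrib, Finset.sum_sub_distrib,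
      ← Finset.mul_sum, Finset.sum_ite_mem, Finset.univ_inter]
    simp only [cost, Finset.sum_ite_eq', Finset.mem_univ, if_true, Nat.cast_sum, Nat.cast_pow,
      Nat.cast_ofNat]
  refine ⟨y, w, ⟨hv, hy, ?_, ?_, ?_⟩, hiy, ?_⟩
  · rintro rfl; simp at hiy
  · rw [hval y hy, if_pos hiy]; ring
  · intro z hz hzv hzy
    rw [hval z hz]
    by_cases hiz : i ∈ diff v z
    · have : cost y < cost z := lt_of_le_of_ne (hle z hz hiz)
        fun h => hzy (hcost z hz y hy hiz hiy h.symm)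
      have : (cost y : ℝ) < cost z := by exact_mod_cast this
      rw [if_pos hiz]; linarith
    · have : 0 < cost z := by
        obtain ⟨k, hk⟩ := Function.ne_iff.1 hzv
        have hk' : k ∈ (diff v z).erase i :=
          Finset.mem_erase.2 ⟨fun h => hiz (h ▸ mem_diff.2 hk.symm), mem_diff.2 hk.symm⟩
        exact Finset.sum_pos (fun _ _ => by positivity) ⟨k, hk'⟩
      have : (0 : ℝ) < cost z := by exact_mod_cast this
      rw [if_neg hiz]; linarith
  · intro k hk
    by_contra hkx
    have hki : k ≠ i := fun h => hkx (h ▸ mem_diff.2 hi)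
    have h1 : 2 ^ e k ≤ cost y := Finset.single_le_sum (f := fun k => 2 ^ e k)
      (fun _ _ => Nat.zero_le _) (Finset.mem_erase.2 ⟨hki, hk⟩)
    have h2 := hle x hx (mem_diff.2 hi)
    have h3 : e k = n + k := by
      simp only [mem_diff, not_not] at hkx
      simp [e, hkx]
    have h4 : 2 ^ n ≤ 2 ^ e k := Nat.pow_le_pow_right (by norm_num) (by omega)
    omega

end SignVec

/-! ### From short edges to exchange and parity -/

namespace SignVec

/-- The far end of an edge from `v` that moves `i` and stays inside `diff v x` is already the
exchanged vector; `j = i` when the edge moves one coordinate. -/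
theorem exchange_of_card_diff_le {n : ℕ} {F : Set (Fin n → SignType)} (hfull : ∀ v ∈ F, IsFull v)
    (hF : ∀ v x w, IsEdgePair F v x w → (diff v x).card ≤ 2) : Exchange F := by
  intro v hv x hx i hi
  obtain ⟨y, w, hy, hiy, hyx⟩ := exists_isEdgePair hfull hv hx hi
  obtain ⟨j, hj, hij⟩ : ∃ j ∈ diff v y, diff v y ⊆ {i, j} := by
    by_cases h : ∃ j ∈ diff v y, j ≠ i
    · obtain ⟨j, hj, hji⟩ := h
      refine ⟨j, hj, ?_⟩
      rw [Finset.eq_of_subset_of_card_le (s := {i, j}) (t := diff v y)]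
      · intro k hk
        rcases Finset.mem_insert.1 hk with rfl | hk
        · exact hiy
        · rwa [Finset.mem_singleton.1 hk]
      · rw [Finset.card_pair hji.symm]; exact hF v y w hy
    · push Not at h
      exact ⟨i, hiy, fun k hk => by simp [h k hk]⟩
  have hyk : ∀ k ∈ diff v y, y k = x k := by
    intro k hk
    have h1 := mem_diff.1 hk
    have h2 := mem_diff.1 (hyx hk)
    have := hfull v hv k
    have := hfull x hx k
    have := hfull y hy.right_mem k
    generalize v k = a at *; generalize x k = b at *; generalize y k = c at *
    revert a b c; decide
  refine ⟨j, mem_diff.1 (hyx hj), ?_⟩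
  convert hy.right_mem using 1
  funext k
  by_cases hkj : k = j
  · subst hkj; simp [hyk k hj]
  · by_cases hki : k = i
    · subst hki; simp [hkj, hyk k hiy]
    · simp only [Function.update_of_ne hkj, Function.update_of_ne hki]
      by_contra h
      have := hij (mem_diff.2 h)
      simp [hkj, hki] at this

/-- Walk from `v` to `x` along edges inside the difference set; each step removes two differences.
-/
theorem even_card_diff {n : ℕ} {F : Set (Fin n → SignType)} (hfull : ∀ v ∈ F, IsFull v)
    (hF : ∀ v x w, IsEdgePair F v x w → (diff v x).card = 2) (m : ℕ) :
    ∀ v ∈ F, ∀ x ∈ F, (diff v x).card = m → Even m := by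
  induction m using Nat.strong_induction_on with
  | _ m ih =>
    intro v hv x hx hm
    by_cases hvx : v = x
    · subst hvx; simp [diff] at hm; simp [← hm]
    · obtain ⟨i, hi⟩ := Function.ne_iff.1 hvx
      obtain ⟨y, w, hy, -, hyx⟩ := exists_isEdgePair hfull hv hx hi
      have h2 := hF v y w hy
      have hd : diff y x = diff v x \ diff v y := by
        ext k
        have hk : v k ≠ y k → v k ≠ x k := fun h => mem_diff.1 (hyx (mem_diff.2 h))
        have := hfull v hv k
        have := hfull x hx k
        have := hfull y hy.right_mem k
        simp only [mem_diff, Finset.mem_sdiff]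
        generalize v k = a at *; generalize x k = b at *; generalize y k = c at *
        revert a b c; decide
      have hc : (diff y x).card = m - 2 := by
        rw [hd, Finset.card_sdiff_of_subset hyx, hm, h2]
      have hle : 2 ≤ m := by rw [← h2, ← hm]; exact Finset.card_le_card hyx
      have := ih (m - 2) (by omega) y hy.right_mem x hx hc
      have e : m = m - 2 + 2 := by omega
      rw [e]; exact this.add even_two

/-! ### Support functions -/

section SupportFunction

variable {ι : Type*} [Fintype ι] [DecidableEq ι]

/-- `g` is the support function of `F`. -/
def IsSupportFunction (F : Set (ι → SignType)) (g : (ι → SignType) → ℤ) : Prop :=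
  ∀ s, (∀ v ∈ F, pairing s v ≤ g s) ∧ ∃ v ∈ F, pairing s v = g s

theorem IsSupportFunction.isRankFunction {F : Set (ι → SignType)} {g : (ι → SignType) → ℤ}
    (hg : IsSupportFunction F g) (hfull : ∀ v ∈ F, IsFull v) (hF : Exchange F) :
    IsRankFunction g where
  zero := by
    obtain ⟨v, -, h⟩ := (hg 0).2
    rw [← h]; simp [pairing]
  single i a ha := by
    obtain ⟨v, hv, h⟩ := (hg (Pi.single i a)).2
    have : pairing (Pi.single i a) v = (a : ℤ) * v i := by
      rw [pairing, Finset.sum_eq_single i] <;> simp +contextual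
    rw [← h, this]
    have : ∀ a b : SignType, |(a : ℤ) * b| ≤ 1 := by decide
    exact this a (v i)
  bisub s t := by
    obtain ⟨v₀, hv₀, -⟩ := (hg 0).2
    obtain ⟨v, hv, h1, h2⟩ := hF.exists_simultaneous_max ⟨v₀, hv₀⟩ hfull
      (a := meet s t) (c := join s t) fun i => by
        simp only [meet, join]
        generalize s i = a; generalize t i = b; revert a b; decide
    obtain ⟨x, hx, ex⟩ := (hg (meet s t)).2
    obtain ⟨y, hy, ey⟩ := (hg (join s t)).2
    have := pairing_meet_add_pairing_join s t v
    have := h1 x hx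
    have := h2 y hy
    have := (hg s).1 v hv
    have := (hg t).1 v hv
    omega
  parity s := by
    obtain ⟨v, hv, h⟩ := (hg s).2
    rw [← h]; exact two_dvd_pairing_sub (hfull v hv) s

/-- If equality fails, both extensions raise `g` by 1. Their maximisers `v` and `x` then differ at
`i` but both attain `g s`. -/
theorem IsSupportFunction.add_eq_two_mul {F : Set (ι → SignType)} {g : (ι → SignType) → ℤ}
    (hg : IsSupportFunction F g) (hr : IsRankFunction g)
    (hfull : ∀ v ∈ F, IsFull v) (heven : ∀ v ∈ F, ∀ x ∈ F, Even (diff v x).card)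
    {s : ι → SignType} {i : ι} (hi : s i = 0) (hs : ∀ k, k ≠ i → s k ≠ 0) :
    g (Function.update s i 1) + g (Function.update s i (-1)) = 2 * g s := by
  have h1 := hr.update_sub hi (a := 1) (by decide)
  have h2 := hr.update_sub hi (a := -1) (by decide)
  have h3 := hr.bisub (Function.update s i 1) (Function.update s i (-1))
  have e1 : meet (Function.update s i 1) (Function.update s i (-1)) = s := by
    funext k
    by_cases h : k = i
    · subst h; simp [meet, hi]
    · simp [meet, h]
  have e2 : join (Function.update s i 1) (Function.update s i (-1)) = s := by
    funext k
    by_cases h : k = i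
    · subst h; simp [join, hi]
    · simp +contextual [join, h]
  rw [e1, e2] at h3
  by_contra hne
  obtain ⟨v, hv, hv'⟩ := (hg (Function.update s i 1)).2
  obtain ⟨x, hx, hx'⟩ := (hg (Function.update s i (-1))).2
  rw [pairing_update_left, hi] at hv' hx'
  have h4 := (hg s).1 v hv
  have h5 := (hg s).1 x hx
  have h6 := scalar_cases (v i)
  have h7 := scalar_cases (x i)
  simp only [SignType.coe_one, SignType.coe_neg, SignType.coe_zero] at hv' hx'
  have h8 : (v i : ℤ) = 1 := by omega
  have h9 : (x i : ℤ) = -1 := by omega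
  have hne' : v i ≠ x i := fun h => by rw [h] at h8; omega
  -- Each difference off `i` contributes 2 or -2 because `s` has no other zero. As the pairings
  -- agree, the number of these differences is even, and `i` makes the total odd.
  have h10 : (4 : ℤ) ∣ pairing s v - pairing s x - 2 * ((diff v x).erase i).card := by
    have : (((diff v x).erase i).card : ℤ) = ∑ k, if k ∈ (diff v x).erase i then 1 else 0 := by
      rw [Finset.sum_ite_mem, Finset.univ_inter, Finset.card_eq_sum_ones, Nat.cast_sum,
        Nat.cast_one]
    rw [this, pairing, pairing, Finset.mul_sum, ← Finset.sum_sub_distrib, ← Finset.sum_sub_distrib]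
    refine Finset.dvd_sum fun k _ => ?_
    by_cases hk : k = i
    · subst hk; simp [hi]
    · have a1 := hs k hk
      have a2 := hfull v hv k
      have a3 := hfull x hx k
      simp only [Finset.mem_erase, mem_diff, ne_eq, hk, not_false_eq_true, true_and]
      generalize s k = a at *; generalize x k = b at *; generalize v k = c at *
      revert a b c; decide
  have h11 := Finset.card_erase_add_one (mem_diff.2 hne')
  obtain ⟨r, hr⟩ := heven v hv x hx
  omega

end SupportFunction

/-! ### Edges of the polytope as pairs of sign vectors -/

/-- A sign vector as a real vector. -/
def toReal {n : ℕ} (s : Fin n → SignType) : Fin n → ℝ := fun i => (s i : ℝ)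

theorem toReal_injective {n : ℕ} : Function.Injective (toReal (n := n)) := by
  intro s t h
  funext i
  have := congrFun h i
  simp only [toReal] at this
  rcases SignType.trichotomy (s i) with h | h | h <;>
    rcases SignType.trichotomy (t i) with h' | h' | h' <;> rw [h, h'] at this ⊢ <;>
    norm_num at this

/-- Krein–Milman for the face: its extreme points are extreme in the whole polytope, hence belong to
`V`. -/
theorem isExposed_subset_convexHull {n : ℕ} {V F : Set (Fin n → ℝ)} (hV : V.Finite)
    (hF : IsExposed ℝ (convexHull ℝ V) F) : F ⊆ convexHull ℝ (V ∩ F) := by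
  have hc : IsCompact F := hF.isCompact (hV.isCompact_convexHull ℝ)
  have hconv : Convex ℝ F := hF.convex (convex_convexHull ℝ V)
  have h1 := closure_convexHull_extremePoints hc hconv
  have h2 : F.extremePoints ℝ ⊆ V ∩ F := fun p hp =>
    ⟨extremePoints_convexHull_subset (hF.isExtreme.extremePoints_subset_extremePoints hp), hp.1⟩
  have h3 : IsClosed (convexHull ℝ (V ∩ F)) := (hV.inter_of_left F).isClosed_convexHull ℝ
  calc F = closure (convexHull ℝ (F.extremePoints ℝ)) := h1.symm
    _ ⊆ convexHull ℝ (V ∩ F) := h3.closure_subset_iff.2 (convexHull_mono h2)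

theorem vectorSpan_eq_of_isExposed {n : ℕ} {V F : Set (Fin n → ℝ)} (hV : V.Finite)
    (hF : IsExposed ℝ (convexHull ℝ V) F) : vectorSpan ℝ F = vectorSpan ℝ (V ∩ F) := by
  refine le_antisymm ?_ (vectorSpan_mono ℝ Set.inter_subset_right)
  refine (vectorSpan_mono ℝ (isExposed_subset_convexHull hV hF)).trans ?_
  rw [← direction_affineSpan, affineSpan_convexHull, direction_affineSpan]

theorem IsEdgePair.exists_isEdge {n : ℕ} {A : Set (Fin n → SignType)} {v x : Fin n → SignType}
    {w : Fin n → ℝ} (h : IsEdgePair A v x w) :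
    ∃ F, IsEdge (convexHull ℝ (toReal '' A)) F ∧
      vectorSpan ℝ F = Submodule.span ℝ {toReal x - toReal v} := by
  let l : (Fin n → ℝ) →L[ℝ] ℝ := ∑ k, w k • ContinuousLinearMap.proj (R := ℝ) k
  have hl : ∀ z, l (toReal z) = ∑ k, w k * (z k : ℝ) := fun z => by simp [l, toReal]
  have hV : (toReal '' A).Finite := Set.toFinite _
  have hmax : ∀ p ∈ convexHull ℝ (toReal '' A), l p ≤ l (toReal v) := by
    intro p hp
    refine convexHull_min ?_ (convex_halfSpace_le l.toLinearMap.isLinear (l (toReal v))) hp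
    rintro _ ⟨z, hz, rfl⟩
    simp only [Set.mem_ofPred_eq, ContinuousLinearMap.coe_coe, hl]
    by_cases h1 : z = v
    · rw [h1]
    by_cases h2 : z = x
    · rw [h2, h.eq]
    exact (h.lt z hz h1 h2).le
  let F := l.toExposed (convexHull ℝ (toReal '' A))
  have hF : IsExposed ℝ (convexHull ℝ (toReal '' A)) F := fun _ => ⟨l, rfl⟩
  have hmem : ∀ z ∈ A, toReal z ∈ F ↔ l (toReal z) = l (toReal v) := by
    intro z hz
    have hz' := subset_convexHull ℝ _ (Set.mem_image_of_mem toReal hz)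
    constructor
    · intro hzF
      exact le_antisymm (hmax _ hz')
        (hzF.2 _ (subset_convexHull ℝ _ (Set.mem_image_of_mem toReal h.left_mem)))
    · intro he
      exact ⟨hz', fun q hq => he ▸ hmax q hq⟩
  have hVF : toReal '' A ∩ F = {toReal x, toReal v} := by
    ext p
    constructor
    · rintro ⟨⟨z, hz, rfl⟩, hzF⟩
      have he := (hmem z hz).1 hzF
      by_contra hne
      simp only [Set.mem_insert_iff, Set.mem_singleton_iff, not_or,
        toReal_injective.eq_iff] at hne
      have := h.lt z hz hne.2 hne.1
      rw [← hl, ← hl] at this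
      exact this.ne he
    · rintro (rfl | rfl)
      · exact ⟨Set.mem_image_of_mem _ h.right_mem, (hmem x h.right_mem).2 (by rw [hl, hl, h.eq])⟩
      · exact ⟨Set.mem_image_of_mem _ h.left_mem, (hmem v h.left_mem).2 rfl⟩
  have hspan : vectorSpan ℝ F = Submodule.span ℝ {toReal x - toReal v} := by
    rw [vectorSpan_eq_of_isExposed hV hF, hVF, vectorSpan_pair, vsub_eq_sub]
  refine ⟨F, ⟨hF, ?_⟩, hspan⟩
  rw [hspan, finrank_span_singleton]
  rw [sub_ne_zero]
  exact fun h' => h.ne (toReal_injective h').symm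

/-- A one-dimensional face contains two of the points. Fullness excludes a third: a line meets the
vertices of the cube in at most two points. -/
theorem exists_isEdgePair_of_isEdge {n : ℕ} {A : Set (Fin n → SignType)}
    (hfull : ∀ v ∈ A, IsFull v) {F : Set (Fin n → ℝ)}
    (hF : IsEdge (convexHull ℝ (toReal '' A)) F) :
    ∃ v x w, IsEdgePair A v x w ∧ vectorSpan ℝ F = Submodule.span ℝ {toReal x - toReal v} := by
  obtain ⟨hexp, hrank⟩ := hF
  have hV : (toReal '' A).Finite := Set.toFinite _
  have hnt : (toReal '' A ∩ F).Nontrivial := by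
    by_contra h
    rw [Set.not_nontrivial_iff] at h
    rw [vectorSpan_eq_of_isExposed hV hexp, vectorSpan_of_subsingleton ℝ h] at hrank
    simp at hrank
  obtain ⟨_, ⟨⟨v, hv, rfl⟩, hvF⟩, _, ⟨⟨x, hx, rfl⟩, hxF⟩, hvx⟩ := hnt
  have hne : v ≠ x := fun h => hvx (h ▸ rfl)
  have hd : toReal x - toReal v ≠ 0 := sub_ne_zero.2 hvx.symm
  have hspan : vectorSpan ℝ F = Submodule.span ℝ {toReal x - toReal v} := by
    symm
    refine Submodule.eq_of_le_of_finrank_eq ?_ ?_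
    · rw [Submodule.span_singleton_le_iff_mem]
      exact vsub_mem_vectorSpan ℝ hxF hvF
    · rw [hrank, finrank_span_singleton hd]
  obtain ⟨l, hl⟩ := hexp ⟨_, hvF⟩
  have hlw : ∀ z : Fin n → SignType, ∑ k, l (Pi.single k 1) * (z k : ℝ) = l (toReal z) := by
    intro z
    have : toReal z = ∑ k, (z k : ℝ) • (Pi.single k 1 : Fin n → ℝ) := by
      funext j
      simp [toReal, Finset.sum_apply, Pi.single_apply]
    rw [this, map_sum]
    simp [mul_comm]
  have hmax : ∀ z ∈ A, toReal z ∈ convexHull ℝ (toReal '' A) := fun z hz =>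
    subset_convexHull ℝ _ (Set.mem_image_of_mem _ hz)
  have hvl := (hl ▸ hvF : toReal v ∈ {x ∈ convexHull ℝ (toReal '' A) | _}).2
  have hxl := (hl ▸ hxF : toReal x ∈ {x ∈ convexHull ℝ (toReal '' A) | _}).2
  refine ⟨v, x, fun k => l (Pi.single k 1), ⟨hv, hx, hne, ?_, ?_⟩, hspan⟩
  · rw [hlw, hlw]
    exact le_antisymm (hxl _ (hmax v hv)) (hvl _ (hmax x hx))
  · intro z hz hzv hzx
    rw [hlw, hlw]
    refine lt_of_le_of_ne (hvl _ (hmax z hz)) fun he => ?_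
    have hzF : toReal z ∈ F := by
      rw [hl]
      exact ⟨hmax z hz, fun q hq => he ▸ hvl q hq⟩
    have hzs := vsub_mem_vectorSpan ℝ hzF hvF
    rw [hspan, vsub_eq_sub, Submodule.mem_span_singleton] at hzs
    obtain ⟨c, hc⟩ := hzs
    have hck : ∀ k, c * ((x k : ℝ) - v k) = (z k : ℝ) - v k := fun k => congrFun hc k
    obtain ⟨k, hk⟩ := Function.ne_iff.1 hne
    have hc01 : c = 0 ∨ c = 1 := by
      have h0 := hck k
      have h1 := hfull v hv k
      have h2 := hfull x hx k
      have h3 := hfull z hz k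
      rcases SignType.trichotomy (v k) with a | a | a <;>
        rcases SignType.trichotomy (x k) with b | b | b <;>
        rcases SignType.trichotomy (z k) with d | d | d <;>
        first
          | exact absurd a h1
          | exact absurd b h2
          | exact absurd d h3
          | exact absurd (a.trans b.symm) hk
          | (rw [a, b, d] at h0
             simp only [SignType.coe_one, SignType.coe_neg] at h0
             first
              | (left; linarith)
              | (right; linarith))
    rcases hc01 with rfl | rfl
    · exact hzv (toReal_injective (sub_eq_zero.1 (by rw [← hc, zero_smul])))
    · exact hzx (toReal_injective (sub_left_inj.1 (hc.symm.trans (one_smul ℝ _))))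

theorem diff_eq_of_span_eq {n : ℕ} {v x : Fin n → SignType} {r : Fin n → ℝ}
    (h : Submodule.span ℝ {toReal x - toReal v} = Submodule.span ℝ {r}) :
    diff v x = Finset.univ.filter fun k => r k ≠ 0 := by
  obtain ⟨z, hz⟩ := Submodule.span_singleton_eq_span_singleton.1 h
  ext k
  have hinj : ∀ a b : SignType, (a : ℝ) = b → a = b := fun a b hab =>
    congrFun (toReal_injective (n := 1) (a₁ := fun _ => a) (a₂ := fun _ => b) (by
      funext; exact hab)) 0
  have hk : (z : ℝ) * ((x k : ℝ) - v k) = r k := congrFun hz k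
  simp only [mem_diff, Finset.mem_filter, Finset.mem_univ, true_and, ← hk, ne_eq, mul_eq_zero,
    z.ne_zero, false_or, sub_eq_zero]
  constructor
  · exact fun h1 h2 => h1 (hinj _ _ h2).symm
  · exact fun h1 h2 => h1 (by rw [h2])

theorem exists_isParallelTo_single_iff {n : ℕ} {v x : Fin n → SignType} {F : Set (Fin n → ℝ)}
    (hF : vectorSpan ℝ F = Submodule.span ℝ {toReal x - toReal v}) :
    (∃ i : Fin n, IsParallelTo F (Pi.single i 1)) ↔ (diff v x).card = 1 := by
  constructor
  · rintro ⟨i, hi⟩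
    rw [diff_eq_of_span_eq (hF.symm.trans hi), Finset.card_eq_one]
    exact ⟨i, by ext k; simp [Pi.single_apply]⟩
  · intro h
    obtain ⟨i, hi⟩ := Finset.card_eq_one.1 h
    have hmem : ∀ k, v k ≠ x k ↔ k = i := fun k => by rw [← mem_diff, hi, Finset.mem_singleton]
    have hd : toReal x - toReal v = (toReal x i - toReal v i) • (Pi.single i 1 : Fin n → ℝ) := by
      funext k
      by_cases hk : k = i
      · subst hk; simp
      · have := not_not.1 (mt (hmem k).1 hk)
        simp [toReal, hk, this]
    refine ⟨i, ?_⟩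
    rw [IsParallelTo, hF, hd, Submodule.span_singleton_smul_eq]
    refine IsUnit.mk0 _ fun h0 => ?_
    rw [h0, zero_smul, sub_eq_zero] at hd
    exact (hmem i).2 rfl (congrFun (toReal_injective hd).symm i)

/-- Between full vectors every changed coordinate moves by 2 or -2, so two changes have equal size
and only their relative sign matters. -/
theorem isParallelToPair_iff {n : ℕ} {v x : Fin n → SignType} (hv : IsFull v) (hx : IsFull x)
    {F : Set (Fin n → ℝ)} (hF : vectorSpan ℝ F = Submodule.span ℝ {toReal x - toReal v}) :
    IsParallelToPair F ↔ (diff v x).card = 2 := by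
  constructor
  · rintro ⟨i, j, hij, h | h⟩
    all_goals
      rw [diff_eq_of_span_eq (hF.symm.trans h), Finset.card_eq_two]
      refine ⟨i, j, hij, ?_⟩
      ext k
      by_cases h1 : k = i
      · subst h1; simp [hij]
      · by_cases h2 : k = j
        · subst h2; simp [h1]
        · simp [h1, h2]
  · intro h
    obtain ⟨i, j, hij, hd⟩ := Finset.card_eq_two.1 h
    have hmem : ∀ k, v k ≠ x k ↔ k = i ∨ k = j := fun k => by rw [← mem_diff, hd]; simp
    have hval : ∀ k, v k ≠ x k → toReal x k - toReal v k = 2 * toReal x k := by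
      intro k hk
      have h1 := hv k
      have h2 := hx k
      simp only [toReal]
      rcases SignType.trichotomy (v k) with a | a | a <;>
        rcases SignType.trichotomy (x k) with b | b | b <;>
        first
          | exact absurd a h1
          | exact absurd b h2
          | exact absurd (a.trans b.symm) hk
          | (rw [a, b]; norm_num)
    have hi := hval i ((hmem i).2 (Or.inl rfl))
    have hj := hval j ((hmem j).2 (Or.inr rfl))
    have hu : IsUnit (2 * toReal x i) := by
      refine IsUnit.mk0 _ (mul_ne_zero two_ne_zero fun h0 => ?_)
      have : (x i : ℝ) = 0 := h0
      have h2 := hx i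
      rcases SignType.trichotomy (x i) with b | b | b
      · rw [b] at this; norm_num at this
      · exact h2 b
      · rw [b] at this; norm_num at this
    have key : ∀ c : ℝ, toReal x j = c * toReal x i → toReal x - toReal v =
        (2 * toReal x i) • (Pi.single i 1 + c • Pi.single j 1 : Fin n → ℝ) := by
      intro c hc
      funext k
      by_cases h1 : k = i
      · subst h1; simp [hij, hi]
      · by_cases h2 : k = j
        · subst h2; rw [Pi.sub_apply, hj, hc]; simp [h1]; ring
        · have := not_not.1 (mt (hmem k).1 (by simp [h1, h2]))
          simp [toReal, h1, h2, this]
    refine ⟨i, j, hij, ?_⟩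
    by_cases hs : x j = x i
    · left
      rw [IsParallelTo, hF, key 1 (by simp [toReal, hs]), one_smul,
        Submodule.span_singleton_smul_eq hu]
    · right
      rw [IsParallelTo, hF, key (-1) ?_, neg_one_smul, ← sub_eq_add_neg,
        Submodule.span_singleton_smul_eq hu]
      have h1 := hx i
      have h2 := hx j
      simp only [toReal]
      rcases SignType.trichotomy (x i) with a | a | a <;>
        rcases SignType.trichotomy (x j) with b | b | b <;>
        first
          | exact absurd a h1
          | exact absurd b h2
          | exact absurd (b.trans a.symm) hs
          | (rw [a, b]; norm_num)

end SignVec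

/-! ### Admissible sets as sign vectors -/

namespace AdS

open SignVec

variable {n : ℕ}

/-- The sign vector of an admissible set. -/
def coord (S : AdS n) : Fin n → SignType := fun i =>
  if Sum.inl i ∈ S.1 then 1 else if Sum.inr i ∈ S.1 then -1 else 0

theorem inl_mem_iff (S : AdS n) (i : Fin n) : Sum.inl i ∈ S.1 ↔ S.coord i = 1 := by
  simp only [coord]
  split_ifs <;> simp_all

theorem inr_mem_iff (S : AdS n) (i : Fin n) : Sum.inr i ∈ S.1 ↔ S.coord i = -1 := by
  have := S.2 i
  simp only [coord]
  split_ifs <;> simp_all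

theorem coord_injective : Function.Injective (coord (n := n)) := by
  intro S T h
  refine Subtype.ext (Finset.ext fun a => ?_)
  rcases a with i | i
  · rw [inl_mem_iff, inl_mem_iff, h]
  · rw [inr_mem_iff, inr_mem_iff, h]

/-- The admissible set with a given sign vector. -/
def ofSign (s : Fin n → SignType) : AdS n :=
  ⟨Finset.univ.filter (fun a => Sum.elim s (-s) a = 1), fun i h => by
    have h1 : s i = 1 := (Finset.mem_filter.1 h.1).2
    have h2 : -s i = 1 := (Finset.mem_filter.1 h.2).2
    rw [h1] at h2
    exact absurd h2 (by decide)⟩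

@[simp] theorem coord_ofSign (s : Fin n → SignType) : (ofSign s).coord = s := by
  funext i
  have h1 : Sum.inl i ∈ (ofSign s).1 ↔ s i = 1 := by simp [ofSign]
  have h2 : Sum.inr i ∈ (ofSign s).1 ↔ s i = -1 := by simp [ofSign, neg_eq_iff_eq_neg]
  simp only [coord, h1, h2]
  generalize s i = a
  revert a; decide

@[simp] theorem ofSign_coord (S : AdS n) : ofSign S.coord = S :=
  coord_injective (coord_ofSign _)

theorem coord_eq_iff {S : AdS n} {s : Fin n → SignType}
    (h1 : ∀ i, Sum.inl i ∈ S.1 ↔ s i = 1) (h2 : ∀ i, Sum.inr i ∈ S.1 ↔ s i = -1) :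
    S.coord = s := by
  funext i
  simp only [coord, h1, h2]
  generalize s i = a
  revert a; decide

theorem coord_empty : (empty n).coord = 0 := by
  funext i; simp [coord, empty]

theorem coord_inter (S T : AdS n) : (S.inter T).coord = meet S.coord T.coord := by
  refine coord_eq_iff (fun i => ?_) fun i => ?_ <;>
  simp only [inter, Finset.mem_inter, inl_mem_iff, inr_mem_iff, meet] <;>
  generalize S.coord i = a <;> generalize T.coord i = b <;> revert a b <;> decide

theorem coord_sqUnion (S T : AdS n) : (S.sqUnion T).coord = join S.coord T.coord := by
  refine coord_eq_iff (fun i => ?_) fun i => ?_ <;>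
  simp only [sqUnion, Finset.mem_filter, Finset.mem_union, Sum.swap_inl, Sum.swap_inr,
    inl_mem_iff, inr_mem_iff, join] <;>
  generalize S.coord i = a <;> generalize T.coord i = b <;> revert a b <;> decide

theorem coord_adjoin_inl (S : AdS n) (i : Fin n) (h : Sum.inr i ∉ S.1) :
    (S.adjoin (Sum.inl i) h).coord = Function.update S.coord i 1 := by
  refine coord_eq_iff (fun k => ?_) fun k => ?_ <;> by_cases hk : k = i
  · subst hk; simp [adjoin]
  · simp [adjoin, hk, inl_mem_iff]
  · subst hk; simpa [adjoin] using h
  · simp [adjoin, hk, inr_mem_iff]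

theorem coord_adjoin_inr (S : AdS n) (i : Fin n) (h : Sum.inl i ∉ S.1) :
    (S.adjoin (Sum.inr i) h).coord = Function.update S.coord i (-1) := by
  refine coord_eq_iff (fun k => ?_) fun k => ?_ <;> by_cases hk : k = i
  · subst hk; simpa [adjoin] using h
  · simp [adjoin, hk, inl_mem_iff]
  · subst hk; simp [adjoin]
  · simp [adjoin, hk, inr_mem_iff]

theorem card_eq_sum (A : Finset (SignedGround n)) : (A.card : ℤ) =
    ∑ i, ((if Sum.inl i ∈ A then 1 else 0) + (if Sum.inr i ∈ A then 1 else 0)) := by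
  have : (A.card : ℤ) = ∑ a, if a ∈ A then 1 else 0 := by simp
  rw [this, Fintype.sum_sum_type, Finset.sum_add_distrib]

theorem card_eq_card_support (S : AdS n) :
    S.1.card = (Finset.univ.filter fun i => S.coord i ≠ 0).card := by
  have : (S.1.card : ℤ) = ((Finset.univ.filter fun i => S.coord i ≠ 0).card : ℤ) := by
    rw [card_eq_sum, Finset.card_filter, Nat.cast_sum]
    refine Finset.sum_congr rfl fun i _ => ?_
    simp only [inl_mem_iff, inr_mem_iff]
    generalize S.coord i = a
    revert a; decide
  exact_mod_cast this

theorem card_eq_iff_isFull (S : AdS n) : S.1.card = n ↔ IsFull S.coord := by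
  rw [card_eq_card_support]
  conv_lhs => rhs; rw [← Finset.card_fin n]
  rw [Finset.card_filter_eq_iff]
  simp [IsFull]

theorem two_dvd_card_sub (S : AdS n) : (2 : ℤ) ∣ S.1.card - ∑ i, (S.coord i : ℤ) := by
  rw [card_eq_sum, ← Finset.sum_sub_distrib]
  refine Finset.dvd_sum fun i _ => ?_
  simp only [inl_mem_iff, inr_mem_iff]
  generalize S.coord i = a
  revert a; decide

theorem card_inter_sub_card_bar_inter (S B : AdS n) :
    ((S.1 ∩ B.1).card : ℤ) - ((S.bar ∩ B.1).card : ℤ) = pairing S.coord B.coord := by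
  rw [card_eq_sum, card_eq_sum, ← Finset.sum_sub_distrib, pairing]
  refine Finset.sum_congr rfl fun i _ => ?_
  have h1 : Sum.inl i ∈ S.bar ↔ Sum.inr i ∈ S.1 := by simp [bar]
  have h2 : Sum.inr i ∈ S.bar ↔ Sum.inl i ∈ S.1 := by simp [bar]
  simp only [Finset.mem_inter, h1, h2, inl_mem_iff, inr_mem_iff]
  generalize S.coord i = a
  generalize B.coord i = b
  revert a b; decide

theorem vec_eq (S : AdS n) : S.vec = toReal S.coord := by
  funext i
  have h : ∑ a ∈ S.1, elemVec a i = ∑ a, if a ∈ S.1 then elemVec a i else 0 := by simp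
  rw [vec, Finset.sum_apply, h, Fintype.sum_sum_type,
    Finset.sum_eq_single i (by simp +contextual [elemVec, eq_comm]) (by simp),
    Finset.sum_eq_single i (by simp +contextual [elemVec, eq_comm]) (by simp)]
  simp only [elemVec, inl_mem_iff, inr_mem_iff, toReal]
  rcases SignType.trichotomy (S.coord i) with h | h | h <;> rw [h] <;> simp

end AdS

/-! ### Delta-matroids and their rank functions -/

open SignVec AdS

theorem feasiblePolytope_eq {n : ℕ} (𝓕 : Finset (AdS n)) :
    feasiblePolytope 𝓕 = convexHull ℝ (toReal '' (coord '' (𝓕 : Set (AdS n)))) := by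
  rw [feasiblePolytope, Set.image_image]
  simp only [← vec_eq]

namespace DeltaMatroid

variable {n : ℕ}

/-- The sign vectors of the feasible sets. -/
def signs (D : DeltaMatroid n) : Set (Fin n → SignType) := coord '' (D.feasible : Set (AdS n))

theorem isFull_of_mem_signs (D : DeltaMatroid n) : ∀ v ∈ D.signs, IsFull v := by
  rintro _ ⟨B, hB, rfl⟩
  exact (card_eq_iff_isFull B).1 (D.card_eq B hB)

theorem isSupportFunction (D : DeltaMatroid n) :
    IsSupportFunction D.signs (fun s => D.rank (ofSign s)) := by
  intro s
  refine ⟨?_, ?_⟩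
  · rintro _ ⟨B, hB, rfl⟩
    have := Finset.le_sup' (fun B : AdS n => (((ofSign s).1 ∩ B.1).card : ℤ) -
      (((ofSign s).bar ∩ B.1).card : ℤ)) hB
    simp only [card_inter_sub_card_bar_inter, coord_ofSign] at this
    simpa only [rank, card_inter_sub_card_bar_inter, coord_ofSign] using this
  · obtain ⟨B, hB, h⟩ := Finset.exists_mem_eq_sup' D.nonempty
      (fun B : AdS n => (((ofSign s).1 ∩ B.1).card : ℤ) - (((ofSign s).bar ∩ B.1).card : ℤ))
    refine ⟨B.coord, ⟨B, hB, rfl⟩, ?_⟩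
    rw [card_inter_sub_card_bar_inter, coord_ofSign] at h
    exact h.symm

theorem exchange_signs (D : DeltaMatroid n) : Exchange D.signs := by
  refine exchange_of_card_diff_le D.isFull_of_mem_signs fun v x w h => ?_
  obtain ⟨F, hF, hspan⟩ := h.exists_isEdge
  rcases D.edges F (by rwa [feasiblePolytope_eq]) with h1 | h1
  · rw [exists_isParallelTo_single_iff hspan] at h1; omega
  · rw [isParallelToPair_iff (D.isFull_of_mem_signs v h.left_mem)
      (D.isFull_of_mem_signs x h.right_mem) hspan] at h1
    omega

theorem isRankFunction (D : DeltaMatroid n) :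
    IsRankFunction (fun s => D.rank (ofSign s)) :=
  D.isSupportFunction.isRankFunction D.isFull_of_mem_signs D.exchange_signs

/-- The delta-matroid of a set system with the exchange property. -/
def ofExchange (𝓕 : Finset (AdS n)) (hne : 𝓕.Nonempty)
    (hfull : ∀ v ∈ coord '' (𝓕 : Set (AdS n)), IsFull v)
    (hex : Exchange (coord '' (𝓕 : Set (AdS n)))) : DeltaMatroid n where
  feasible := 𝓕
  nonempty := hne
  card_eq B hB := (card_eq_iff_isFull B).2 (hfull _ ⟨B, hB, rfl⟩)
  edges F hF := by
    rw [feasiblePolytope_eq] at hF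
    obtain ⟨v, x, w, h, hspan⟩ := exists_isEdgePair_of_isEdge hfull hF
    rw [exists_isParallelTo_single_iff hspan,
      isParallelToPair_iff (hfull v h.left_mem) (hfull x h.right_mem) hspan]
    have h1 := hex.card_diff_le h
    have h2 : 0 < (diff v x).card := Finset.card_pos.2 (by
      obtain ⟨i, hi⟩ := Function.ne_iff.1 h.ne
      exact ⟨i, mem_diff.2 hi⟩)
    omega

theorem exists_rank_eq {g : AdS n → ℤ} (hg : IsRankFunction fun s => g (ofSign s)) :
    ∃ D : DeltaMatroid n, g = D.rank := by
  classical
  let 𝓕 : Finset (AdS n) := Finset.univ.filter fun B => B.coord ∈ feas fun s => g (ofSign s)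
  have h𝓕 : coord '' (𝓕 : Set (AdS n)) = feas fun s => g (ofSign s) := by
    ext v
    constructor
    · rintro ⟨B, hB, rfl⟩
      exact (Finset.mem_filter.1 hB).2
    · intro hv
      exact ⟨ofSign v, Finset.mem_filter.2 ⟨Finset.mem_univ _, by rwa [coord_ofSign]⟩,
        coord_ofSign v⟩
  have hne : 𝓕.Nonempty := by
    obtain ⟨y, hy, -⟩ := hg.exists_feas_pairing_eq 0
    rw [← h𝓕] at hy
    obtain ⟨B, hB, -⟩ := hy
    exact ⟨B, hB⟩
  let D := ofExchange 𝓕 hne (by rw [h𝓕]; exact fun v hv => hv.1) (by rw [h𝓕]; exact hg.exchange_feas)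
  have hD : D.signs = feas fun s => g (ofSign s) := h𝓕
  refine ⟨D, funext fun S => ?_⟩
  obtain ⟨h1, v, hv, hv'⟩ := D.isSupportFunction S.coord
  obtain ⟨y, hy, hy'⟩ := hg.exists_feas_pairing_eq S.coord
  rw [hD] at h1 hv
  have h2 := hv.2 S.coord
  have h3 := h1 y hy
  simp only [ofSign_coord] at *
  omega

theorem isRankFunction_iff {g : AdS n → ℤ} : IsRankFunction (fun s => g (ofSign s)) ↔
    g (AdS.empty n) = 0 ∧ (∀ S : AdS n, S.1.card = 1 → |g S| ≤ 1) ∧ IsBisubmodular g ∧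
      ∀ S : AdS n, g S ≡ (S.1.card : ℤ) [ZMOD 2] := by
  have h0 : ofSign (0 : Fin n → SignType) = AdS.empty n := coord_injective (by simp [coord_empty])
  have hm : ∀ S T : AdS n, ofSign (meet S.coord T.coord) = S.inter T := fun S T => by
    rw [← coord_inter, ofSign_coord]
  have hj : ∀ S T : AdS n, ofSign (join S.coord T.coord) = S.sqUnion T := fun S T => by
    rw [← coord_sqUnion, ofSign_coord]
  constructor
  · intro h
    refine ⟨h0 ▸ h.zero, fun S hS => ?_, fun S T => ?_, fun S => ?_⟩
    · rw [card_eq_card_support, Finset.card_eq_one] at hS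
      obtain ⟨i, hi⟩ := hS
      have hi' : ∀ k, S.coord k ≠ 0 ↔ k = i := fun k => by
        rw [← Finset.mem_singleton, ← hi]; simp
      have hS : S.coord = Pi.single i (S.coord i) := by
        funext k
        by_cases hk : k = i
        · subst hk; simp
        · simp [hk, not_not.1 (mt (hi' k).1 hk)]
      have := h.single i (S.coord i) ((hi' i).2 rfl)
      rwa [← hS, ofSign_coord] at this
    · have := h.bisub S.coord T.coord
      simp only [hm, hj, ofSign_coord] at this
      exact this
    · have h1 := h.parity S.coord
      have h2 := two_dvd_card_sub S
      rw [ofSign_coord] at h1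
      refine Int.ModEq.symm (Int.modEq_iff_dvd.2 ?_)
      have := dvd_sub h1 h2
      rwa [sub_sub_sub_cancel_right] at this
  · rintro ⟨h1, h2, h3, h4⟩
    refine ⟨h0.symm ▸ h1, fun i a ha => h2 _ ?_, fun s t => ?_, fun s => ?_⟩
    · rw [card_eq_card_support, coord_ofSign, Finset.card_eq_one]
      exact ⟨i, by ext k; simp [Pi.single_apply, ha]⟩
    · have := h3 (ofSign s) (ofSign t)
      rwa [← hm, ← hj, coord_ofSign, coord_ofSign] at this
    · have := dvd_add (Int.modEq_iff_dvd.1 (h4 (ofSign s)).symm) (two_dvd_card_sub (ofSign s))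
      rwa [sub_add_sub_cancel, coord_ofSign] at this

/-- For the converse, an edge parallel to `e_i` joins feasible `v` and `x` differing only at `i`.
Erasing `i` leaves a set of rank at most `n - 1`, while both of its extensions are feasible and have
rank at least `n`. -/
theorem isEven_iff (D : DeltaMatroid n) : D.IsEven ↔
    ∀ (S : AdS n) (i : Fin n) (hi : Sum.inl i ∉ S.1) (hi' : Sum.inr i ∉ S.1),
      S.1.card + 1 = n →
        D.rank (S.adjoin (Sum.inl i) hi') + D.rank (S.adjoin (Sum.inr i) hi) = 2 * D.rank S := by
  have hup : ∀ S : AdS n, ∀ i (hi : Sum.inl i ∉ S.1) (hi' : Sum.inr i ∉ S.1),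
      S.adjoin (Sum.inl i) hi' = ofSign (Function.update S.coord i 1) ∧
      S.adjoin (Sum.inr i) hi = ofSign (Function.update S.coord i (-1)) := fun S i hi hi' =>
    ⟨by rw [← coord_adjoin_inl S i hi', ofSign_coord],
      by rw [← coord_adjoin_inr S i hi, ofSign_coord]⟩
  constructor
  · intro hD S i hi hi' hS
    have hcard : ∀ v x w, IsEdgePair D.signs v x w → (diff v x).card = 2 := by
      intro v x w h
      obtain ⟨F, hF, hspan⟩ := h.exists_isEdge
      exact (isParallelToPair_iff (D.isFull_of_mem_signs v h.left_mem)
        (D.isFull_of_mem_signs x h.right_mem) hspan).1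
        (hD F (by rwa [polytope, feasiblePolytope_eq]))
    have hSi : S.coord i = 0 := by
      rw [inl_mem_iff] at hi
      rw [inr_mem_iff] at hi'
      generalize S.coord i = a at *
      revert a; decide
    have hSk : ∀ k, k ≠ i → S.coord k ≠ 0 := by
      intro k hk hk0
      rw [card_eq_card_support] at hS
      have hsub : (Finset.univ.filter fun l => S.coord l ≠ 0) ⊆ Finset.univ \ {i, k} := by
        intro l hl
        have hl := (Finset.mem_filter.1 hl).2
        simp only [Finset.mem_sdiff, Finset.mem_univ, true_and, Finset.mem_insert,
          Finset.mem_singleton, not_or]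
        exact ⟨fun h => hl (h ▸ hSi), fun h => hl (h ▸ hk0)⟩
      have h1 := Finset.card_le_card hsub
      rw [Finset.card_sdiff_of_subset (Finset.subset_univ _), Finset.card_pair hk.symm,
        Finset.card_fin] at h1
      have := i.pos
      omega
    have := D.isSupportFunction.add_eq_two_mul D.isRankFunction D.isFull_of_mem_signs
      (fun v hv x hx => even_card_diff D.isFull_of_mem_signs hcard _ v hv x hx rfl) hSi hSk
    simpa only [← (hup S i hi hi').1, ← (hup S i hi hi').2, ofSign_coord] using this
  · intro h F hF
    rw [polytope, feasiblePolytope_eq] at hF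
    obtain ⟨v, x, w, hvx, hspan⟩ := exists_isEdgePair_of_isEdge D.isFull_of_mem_signs hF
    have hv := D.isFull_of_mem_signs v hvx.left_mem
    have hx := D.isFull_of_mem_signs x hvx.right_mem
    rcases D.edges F (by rwa [feasiblePolytope_eq]) with h1 | h1
    swap
    · exact h1
    exfalso
    rw [exists_isParallelTo_single_iff hspan] at h1
    obtain ⟨i, hi⟩ := Finset.card_eq_one.1 h1
    have hmem : ∀ k, v k ≠ x k ↔ k = i := fun k => by rw [← mem_diff, hi, Finset.mem_singleton]
    set s := Function.update v i 0 with hs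
    have hsi : s i = 0 := by simp [hs]
    have hsx : s = Function.update x i 0 := by
      funext k
      by_cases hk : k = i
      · subst hk; simp [hs]
      · simp [hs, hk, not_not.1 (mt (hmem k).1 hk)]
    have hpair : ∀ y : Fin n → SignType, IsFull y → pairing y y = n := fun y hy => by
      have : ∀ k, (y k : ℤ) * y k = 1 := fun k => by
        have := hy k; revert this; generalize y k = a; revert a; decide
      simp [pairing, this]
    have hle : ∀ t u : Fin n → SignType, IsFull u →
        pairing t u ≤ ((Finset.univ.filter fun k => t k ≠ 0).card : ℤ) := fun t u hu => by
      rw [Finset.card_filter, Nat.cast_sum]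
      refine Finset.sum_le_sum fun k _ => ?_
      generalize t k = a; generalize u k = b; revert a b; decide
    have hcard : (Finset.univ.filter fun k => s k ≠ 0).card + 1 = n := by
      have : (Finset.univ.filter fun k => s k ≠ 0) = Finset.univ.erase i := by
        ext k
        by_cases hk : k = i
        · subst hk; simp [hs]
        · simp [hs, hk, hv k]
      rw [this, Finset.card_erase_add_one (Finset.mem_univ i), Finset.card_fin]
    have hnl : Sum.inl i ∉ (ofSign s).1 := by rw [inl_mem_iff, coord_ofSign, hsi]; decide
    have hnr : Sum.inr i ∉ (ofSign s).1 := by rw [inr_mem_iff, coord_ofSign, hsi]; decide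
    have key := h (ofSign s) i hnl hnr (by rw [card_eq_card_support, coord_ofSign]; exact hcard)
    rw [(hup _ i hnl hnr).1, (hup _ i hnl hnr).2, coord_ofSign] at key
    have hS : D.rank (ofSign s) ≤ n - 1 := by
      obtain ⟨u, hu, hu'⟩ := (D.isSupportFunction s).2
      have := hle s u (D.isFull_of_mem_signs u hu)
      simp only at hu'
      omega
    have hval : ∀ y ∈ D.signs, s = Function.update y i 0 →
        (n : ℤ) ≤ D.rank (ofSign (Function.update s i (y i))) := by
      intro y hy hsy
      rw [hsy, Function.update_idem, Function.update_eq_self,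
        ← hpair y (D.isFull_of_mem_signs y hy)]
      exact (D.isSupportFunction y).1 y hy
    have hv1 := hval v hvx.left_mem rfl
    have hx1 := hval x hvx.right_mem hsx
    have hcases : (v i = 1 ∧ x i = -1) ∨ (v i = -1 ∧ x i = 1) := by
      have h1 := hv i
      have h2 := hx i
      have h3 := (hmem i).2 rfl
      clear hv1 hx1
      revert h1 h2 h3
      generalize v i = a; generalize x i = b
      revert a b; decide
    rcases hcases with ⟨e1, e2⟩ | ⟨e1, e2⟩ <;> rw [e1] at hv1 <;> rw [e2] at hx1 <;> omega

end DeltaMatroid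

theorem theorem1p2 (n : ℕ) :
    (∀ g : AdS n → ℤ,
      (∃ D : DeltaMatroid n, g = D.rank) ↔
        g (AdS.empty n) = 0 ∧
        (∀ S : AdS n, S.1.card = 1 → |g S| ≤ 1) ∧
        IsBisubmodular g ∧
        (∀ S : AdS n, g S ≡ (S.1.card : ℤ) [ZMOD 2])) ∧
    (∀ D : DeltaMatroid n,
      D.IsEven ↔
        ∀ (S : AdS n) (i : Fin n) (hi : Sum.inl i ∉ S.1) (hi' : Sum.inr i ∉ S.1),
          S.1.card + 1 = n →
            (D.rank S : ℝ) =
              ((D.rank (S.adjoin (Sum.inl i) hi') : ℝ) +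
                (D.rank (S.adjoin (Sum.inr i) hi) : ℝ)) / 2) := by
  refine ⟨fun g => ?_, fun D => ?_⟩
  · rw [← DeltaMatroid.isRankFunction_iff]
    refine ⟨?_, DeltaMatroid.exists_rank_eq⟩
    rintro ⟨D, rfl⟩
    exact D.isRankFunction
  · rw [D.isEven_iff]
    refine forall₅_congr fun S i hi hi' hS => ?_
    rw [eq_div_iff two_ne_zero, mul_comm, eq_comm]
    norm_cast
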